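/- **Setting.** A sub-distribution on $A$ is a map $\mu:A\to[0,1]$ with $\sum_a\mu(a)\le 1$; a left-partial $R$-coupling of $\mu_1$ and $\mu_2$ is a sub-distribution on pairs, supported in $R$, with first marginal equal to $\mu_1$ and second marginal at most $\mu_2$ pointwise; we write $\mu_1\lesssim\mu_2:R$ if one exists. For a (sub-)Markov chain on $S$ with a set of final states that have no outgoing transitions, $\mathrm{execTerm}(s)$ is the probability (the limit over $n$ of the probability within $n$ steps) of reaching a final state from $s$. A state or configuration is reducible, $\mathrm{red}$, if it has a transition of positive probability. Programs are those of an untyped call-by-value (right-to-left) ML-like language with recursive functions, pairs, sums, a higher-order heap, uniform sampling $\mathrm{rand}\,N$ on $\{0,\dots,N\}$, and presampling tapes (allocation of a tape of bound $N$, and labelled sampling, which deterministically takes the first sample from its tape if that tape is non-empty and of the right bound, and otherwise samples uniformly). Program configurations $(e,\sigma)$, where $\sigma$ consists of a finite heap and finitely many tapes, form a Markov chain, whose final configurations are those in which $e$ is a value. Let $\mathrm{flip}=(\mathrm{rand}\,1==1)$ and $$\mathrm{rec}\ \mathrm{listgen}\ f=\ \mathrm{if}\ \mathrm{flip}\ \mathrm{then}\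 \mathrm{None}\ \mathrm{else}\ \mathrm{let}\ h=f()\ \mathrm{in}\ \mathrm{let}\ t=\mathrm{listgen}\ f\ \mathrm{in}\ \mathrm{Some}(h,t).$$ **Logic.** Propositions are step-indexed predicates on resources (downward closed in the step index, upward closed in the resource), with the usual separation-logic connectives $*$ and $-\!*$, the later modality $\triangleright$, the persistence modality $\Box$, and the basic update modality $\dot{\mid\!\Rrightarrow}$ (frame-preserving update of resources). Resources are authoritative views of the model state, of the heap and of the tapes: $\mathrm{spec}(m)$ is exclusive ownership of the fragment saying that the model is in state $m$, and $G(m)$ and $S(\sigma)$ are the authoritative interpretations of the model state $m$ and of the program state $\sigma$. The coupling precondition $\mathrm{cpl}(m,(e,\sigma),Z)$ is the least predicate that holds if, for some relation $R$, one of the following holds: 1. $\mathrm{red}(e,\sigma)$, $\delta_m\lesssim\mathrm{step}(e,\sigma):R$ and $\forall (m',\rho')\in R.\ Z(m',\rho')$; 2. $\mathrm{red}(e,\sigma)$, $\mathrm{red}(m)$, $\mathrm{step}(m)\lesssim\mathrm{step}(e,\sigma):R$ and $\forall (m',\rho')\in R.\ \triangleright Z(m',\rho')$; 3. $\mathrm{red}(m)$,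 $\mathrm{step}(m)\lesssim\delta_{(e,\sigma)}:R$ and $\forall m'$ with $(m',(e,\sigma))\in R$: $\triangleright\,\mathrm{cpl}(m',(e,\sigma),Z)$; 4. $\mathrm{red}(m)$, $\mathrm{step}(m)\lesssim\mathrm{presample}(\sigma,\ell):R$ for a list $\ell$ of labels of tapes in $\sigma$ (one uniform sample is appended to the tape of each label in turn), and $\forall (m',\sigma')\in R.\ \triangleright\,\mathrm{cpl}(m',(e,\sigma'),Z)$. The refinement weakest precondition $\mathrm{rwp}\,e\,\{\Phi\}$ is the least solution $W(e)$ of: either $e$ is a value and $\dot{\mid\!\Rrightarrow}\Phi(e)$, or $e$ is not a value and $$\forall m,\sigma.\ G(m)*S(\sigma)\,-\!*\ \dot{\mid\!\Rrightarrow}\,\mathrm{cpl}\bigl(m,(e,\sigma),\lambda m',(e',\sigma').\ \dot{\mid\!\Rrightarrow}(G(m')*S(\sigma')*W(e'))\bigr).$$ The Hoare triple $\{P\}\,e\,\{v.\,Q\}$ is $\Box(P-\!*\,\mathrm{rwp}\,e\,\{v.\,Q\})$. **Model.** The three-state Markov chain with final state $q_f$ and transitions $q_0\to q_f$, $q_0\to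 q_1$, $q_1\to q_1$, $q_1\to q_0$, each of probability $\tfrac12$. **Theorem.** Relative to this model, all of the following hold. 1. $\vdash\{\mathrm{spec}(q_1)\}\ \mathrm{listgen}\,(\lambda\_.\,\mathrm{flip})\ \{\_.\ \mathrm{spec}(q_0)\}$. 2. $\vdash\{\mathrm{spec}(q_0)\}\ \mathrm{listgen}\,(\lambda\_.\,\mathrm{listgen}\,(\lambda\_.\,\mathrm{flip}))\ \{\_.\ \mathrm{spec}(q_f)\}$. 3. The nested program $e=\mathrm{listgen}\,(\lambda\_.\,\mathrm{listgen}\,(\lambda\_.\,\mathrm{flip}))$ refines the model started in $q_0$: $\mathrm{spec}(q_0)\vdash\mathrm{rwp}\,e\,\{\_.\ \mathrm{spec}(q_f)\}$, and $\mathrm{execTerm}(q_0)\le\mathrm{execTerm}(e,\sigma)$ for every program state $\sigma$. 4. The function $q_f\mapsto 0$, $q_0\mapsto 2$, $q_1\mapsto 3$ is a ranking supermartingale for the model with $\varepsilon=\tfrac12$ (from every non-final state the chain moves with total probability $1$, and the expected value after the move is at most the present value minus $\varepsilon$), and the model terminates almost surely: $\mathrm{execTerm}(q)=1$ for each of its states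 $q$. 5. Consequently the program terminates almost surely: $\mathrm{execTerm}(e,\sigma)=1$ for every program state $\sigma$. -/

import Mathlib

open scoped ENNReal NNReal

noncomputable section

namespace Caliper

/-! ## Sub-distributions and left-partial couplings -/

/-- Discrete sub-distributions: mass functions of total mass at most one. (Summability forces the
support to be countable, so the carrier need not be assumed countable.) -/
structure SubDistr (A : Type*) where
  mass : A → ℝ≥0∞
  tsum_le_one : ∑' a, mass a ≤ 1

namespace SubDistr

variable {A B : Type*}

/-- The everywhere-zero sub-distribution. -/
def zero : SubDistr A := ⟨fun _ => 0, by simp⟩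

open Classical in
/-- The Dirac distribution. -/
def ret (a : A) : SubDistr A := ⟨fun a' => if a' = a then 1 else 0, by simp⟩

/-- Monadic bind: `(bind μ f)(b) = ∑ₐ μ(a) · f(a)(b)`. -/
def bind (μ : SubDistr A) (f : A → SubDistr B) : SubDistr B :=
  ⟨fun b => ∑' a, μ.mass a * (f a).mass b, by
    rw [ENNReal.tsum_comm]
    calc ∑' a, ∑' b, μ.mass a * (f a).mass b
        = ∑' a, μ.mass a * ∑' b, (f a).mass b := by simp_rw [ENNReal.tsum_mul_left]
      _ ≤ ∑' a, μ.mass a * 1 := by gcongr with a; exact (f a).tsum_le_one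
      _ ≤ 1 := by simpa using μ.tsum_le_one⟩

/-- Push-forward of a sub-distribution. -/
def map (g : A → B) (μ : SubDistr A) : SubDistr B := bind μ (fun a => ret (g a))

/-- The uniform distribution on `{0, …, N}`. -/
def uniform (N : ℕ) : SubDistr (Fin (N + 1)) :=
  ⟨fun _ => ((N : ℝ≥0∞) + 1)⁻¹, by
    rw [tsum_fintype]
    simp only [Finset.sum_const, Finset.card_univ, Fintype.card_fin, nsmul_eq_mul]
    push_cast
    rw [ENNReal.mul_inv_cancel (by simp) (by finiteness)]⟩

/-- `μ` is a left-partial `R`-coupling of `μ₁` and `μ₂`. -/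
structure IsLeftPartialCoupling (μ : SubDistr (A × B)) (μ₁ : SubDistr A) (μ₂ : SubDistr B)
    (R : A → B → Prop) : Prop where
  left : ∀ a, ∑' b, μ.mass (a, b) = μ₁.mass a
  right : ∀ b, ∑' a, μ.mass (a, b) ≤ μ₂.mass b
  supp : ∀ a b, 0 < μ.mass (a, b) → R a b

/-- `μ₁ ≲ μ₂ : R`, existence of a left-partial `R`-coupling. -/
def RCoupl (μ₁ : SubDistr A) (μ₂ : SubDistr B) (R : A → B → Prop) : Prop :=
  ∃ μ : SubDistr (A × B), IsLeftPartialCoupling μ μ₁ μ₂ R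

end SubDistr

/-! ## Markov chains, execution and termination probability -/

/-- A (sub-)Markov chain with a predicate of final states, which have no outgoing transition. -/
structure MarkovChain (S : Type*) where
  step : S → SubDistr S
  isFinal : S → Prop
  final_step : ∀ s, isFinal s → ∀ s', (step s).mass s' = 0

namespace MarkovChain

variable {S : Type*} (M : MarkovChain S)

/-- A state is reducible if it has a transition of positive probability. -/
def Red (s : S) : Prop := ∃ s', 0 < (M.step s).mass s'

open Classical in
/-- Stratified execution: the sub-distribution over the final states reached from `s` in at most
`n` steps. -/
def execN : ℕ → S → SubDistr S
  | 0, s => if M.isFinal s then SubDistr.ret s else SubDistr.zero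
  | n + 1, s => if M.isFinal s then SubDistr.ret s else (M.step s).bind (execN n)

theorem execN_mono_succ (n : ℕ) (s s' : S) :
    (M.execN n s).mass s' ≤ (M.execN (n + 1) s).mass s' := by
  induction n generalizing s s' with
  | zero =>
    by_cases h : M.isFinal s
    · simp [execN, h]
    · simp [execN, h, SubDistr.zero]
  | succ n ih =>
    by_cases h : M.isFinal s
    · simp [execN, h]
    · rw [execN, execN, if_neg h, if_neg h]
      exact ENNReal.tsum_le_tsum fun a => by gcongr; exact ih a s'

theorem execN_mono (s s' : S) : Monotone fun n => (M.execN n s).mass s' :=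
  monotone_nat_of_le_succ fun n => M.execN_mono_succ n s s'

/-- The sub-distribution of final states reached from `s`: the limit (see `tendsto_execN`), i.e.
the supremum, of the stratified executions. -/
def exec (s : S) : SubDistr S :=
  ⟨fun s' => ⨆ n, (M.execN n s).mass s', by
    rw [ENNReal.tsum_eq_iSup_sum]
    refine iSup_le fun F => ?_
    rw [ENNReal.finsetSum_iSup_of_monotone fun s' => M.execN_mono s s']
    exact iSup_le fun n => (ENNReal.sum_le_tsum F).trans (M.execN n s).tsum_le_one⟩

theorem tendsto_execN (s s' : S) :
    Filter.Tendsto (fun n => (M.execN n s).mass s') Filter.atTop (nhds ((M.exec s).mass s')) :=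
  tendsto_atTop_iSup (M.execN_mono s s')

/-- The probability that an execution from `s` terminates. -/
def execTerm (s : S) : ℝ≥0∞ := ∑' s', (M.exec s).mass s'

/-- `f` is a ranking supermartingale with decrement `ε > 0`: every non-final state moves with
full probability, and the expected value of `f` after the move is at most `f s - ε`. -/
structure IsRankingSupermartingale (f : S → ℝ≥0) (ε : ℝ≥0) : Prop where
  pos : 0 < ε
  total : ∀ s, ¬ M.isFinal s → ∑' s', (M.step s).mass s' = 1
  decrease : ∀ s, ¬ M.isFinal s → ∑' s', (M.step s).mass s' * f s' + ε ≤ f s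

end MarkovChain

/-! ## The programming language -/

/-- Variables are numbered; in binding position `none` is the anonymous binder `_`. -/
abbrev Var := ℕ
abbrev Binder := Option Var
abbrev Loc := ℕ
abbrev Label := ℕ

inductive UnOp
  | not | neg

inductive BinOp
  | add | sub | mul | eq | lt | le

mutual
/-- Values. `recV f x e` is `rec f x = e`; `lbl` is a presampling tape label. -/
inductive Val : Type
  | int (z : ℤ)
  | bool (b : Bool)
  | unit
  | loc (l : Loc)
  | lbl (i : Label)
  | recV (f x : Binder) (e : Expr)
  | pair (v w : Val)
  | inl (v : Val)
  | inr (v : Val)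

/-- Expressions. `rand e` is the unlabelled sampling operation and `randT e₁ e₂` the one labelled
with a tape. -/
inductive Expr : Type
  | val (v : Val)
  | var (x : Var)
  | unop (op : UnOp) (e : Expr)
  | binop (op : BinOp) (e₁ e₂ : Expr)
  | app (e₁ e₂ : Expr)
  | ite (e e₁ e₂ : Expr)
  | pair (e₁ e₂ : Expr)
  | fst (e : Expr)
  | snd (e : Expr)
  | inl (e : Expr)
  | inr (e : Expr)
  | case (e : Expr) (x : Binder) (e₁ : Expr) (y : Binder) (e₂ : Expr)
  | alloc (e : Expr)
  | load (e : Expr)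
  | store (e₁ e₂ : Expr)
  | rand (e : Expr)
  | allocTape (e : Expr)
  | randT (e₁ e₂ : Expr)
end

mutual
/-- Substitution of the (closed) value `u` for the free occurrences of `z`. -/
def Val.subst (z : Var) (u : Val) : Val → Val
  | .int k => .int k
  | .bool b => .bool b
  | .unit => .unit
  | .loc l => .loc l
  | .lbl i => .lbl i
  | .recV f x e => if f = some z ∨ x = some z then .recV f x e else .recV f x (Expr.subst z u e)
  | .pair v w => .pair (Val.subst z u v) (Val.subst z u w)
  | .inl v => .inl (Val.subst z u v)
  | .inr v => .inr (Val.subst z u v)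

def Expr.subst (z : Var) (u : Val) : Expr → Expr
  | .val v => .val (Val.subst z u v)
  | .var x => if x = z then .val u else .var x
  | .unop op e => .unop op (e.subst z u)
  | .binop op e₁ e₂ => .binop op (e₁.subst z u) (e₂.subst z u)
  | .app e₁ e₂ => .app (e₁.subst z u) (e₂.subst z u)
  | .ite e e₁ e₂ => .ite (e.subst z u) (e₁.subst z u) (e₂.subst z u)
  | .pair e₁ e₂ => .pair (e₁.subst z u) (e₂.subst z u)
  | .fst e => .fst (e.subst z u)
  | .snd e => .snd (e.subst z u)
  | .inl e => .inl (e.subst z u)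
  | .inr e => .inr (e.subst z u)
  | .case e x e₁ y e₂ =>
      .case (e.subst z u) x (if x = some z then e₁ else e₁.subst z u)
        y (if y = some z then e₂ else e₂.subst z u)
  | .alloc e => .alloc (e.subst z u)
  | .load e => .load (e.subst z u)
  | .store e₁ e₂ => .store (e₁.subst z u) (e₂.subst z u)
  | .rand e => .rand (e.subst z u)
  | .allocTape e => .allocTape (e.subst z u)
  | .randT e₁ e₂ => .randT (e₁.subst z u) (e₂.subst z u)
end

/-- Substitution for a binder; nothing happens at the anonymous one. -/
def Expr.substB : Binder → Val → Expr → Expr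
  | none, _, e => e
  | some x, u, e => e.subst x u

def Expr.IsVal (e : Expr) : Prop := ∃ v, e = .val v

/-- The contents of a presampling tape: a bound `N` and a list of samples from `{0, …, N}`. -/
abbrev Tape := Σ N : ℕ, List (Fin (N + 1))

/-- Program states: a finite heap and finitely many presampling tapes. -/
structure State where
  heap : Finmap fun _ : Loc => Val
  tapes : Finmap fun _ : Label => Tape

abbrev Conf := Expr × State

/-- A key that does not occur in the finite map. -/
def freshKey {V : Type*} (m : Finmap fun _ : ℕ => V) : ℕ := m.keys.sup id + 1

/-- The layers of evaluation contexts; evaluation is from right to left. -/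
inductive EctxItem
  | unop (op : UnOp)
  | binopR (op : BinOp) (e : Expr)
  | binopL (op : BinOp) (v : Val)
  | appR (e : Expr)
  | appL (v : Val)
  | ite (e₁ e₂ : Expr)
  | pairR (e : Expr)
  | pairL (v : Val)
  | fst
  | snd
  | inl
  | inr
  | case (x : Binder) (e₁ : Expr) (y : Binder) (e₂ : Expr)
  | alloc
  | load
  | storeR (e : Expr)
  | storeL (v : Val)
  | rand
  | allocTape
  | randTR (e : Expr)
  | randTL (v : Val)

def EctxItem.fill : EctxItem → Expr → Expr
  | .unop op, h => .unop op h
  | .binopR op e, h => .binop op e h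
  | .binopL op v, h => .binop op h (.val v)
  | .appR e, h => .app e h
  | .appL v, h => .app h (.val v)
  | .ite e₁ e₂, h => .ite h e₁ e₂
  | .pairR e, h => .pair e h
  | .pairL v, h => .pair h (.val v)
  | .fst, h => .fst h
  | .snd, h => .snd h
  | .inl, h => .inl h
  | .inr, h => .inr h
  | .case x e₁ y e₂, h => .case h x e₁ y e₂
  | .alloc, h => .alloc h
  | .load, h => .load h
  | .storeR e, h => .store e h
  | .storeL v, h => .store h (.val v)
  | .rand, h => .rand h
  | .allocTape, h => .allocTape h
  | .randTR e, h => .randT e h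
  | .randTL v, h => .randT h (.val v)

/-- An evaluation context is a list of context items, the outermost first. -/
abbrev Ectx := List EctxItem

def Ectx.fill (K : Ectx) (e : Expr) : Expr := List.foldr EctxItem.fill e K

def Ectx.push (Ki : EctxItem) (d : Ectx × Expr) : Ectx × Expr := (Ki :: d.1, d.2)

/-- The decomposition of an expression into an evaluation context and the sub-expression in
evaluation position, none of whose immediate sub-expressions remains to be evaluated. -/
def Expr.decomp : Expr → Ectx × Expr
  | .val v => ([], .val v)
  | .var x => ([], .var x)
  | .unop op (.val v) => ([], .unop op (.val v))
  | .unop op e => Ectx.push (.unop op) e.decomp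
  | .binop op (.val v) (.val w) => ([], .binop op (.val v) (.val w))
  | .binop op e (.val w) => Ectx.push (.binopL op w) e.decomp
  | .binop op e₁ e₂ => Ectx.push (.binopR op e₁) e₂.decomp
  | .app (.val v) (.val w) => ([], .app (.val v) (.val w))
  | .app e (.val w) => Ectx.push (.appL w) e.decomp
  | .app e₁ e₂ => Ectx.push (.appR e₁) e₂.decomp
  | .ite (.val v) e₁ e₂ => ([], .ite (.val v) e₁ e₂)
  | .ite e e₁ e₂ => Ectx.push (.ite e₁ e₂) e.decomp
  | .pair (.val v) (.val w) => ([], .pair (.val v) (.val w))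
  | .pair e (.val w) => Ectx.push (.pairL w) e.decomp
  | .pair e₁ e₂ => Ectx.push (.pairR e₁) e₂.decomp
  | .fst (.val v) => ([], .fst (.val v))
  | .fst e => Ectx.push .fst e.decomp
  | .snd (.val v) => ([], .snd (.val v))
  | .snd e => Ectx.push .snd e.decomp
  | .inl (.val v) => ([], .inl (.val v))
  | .inl e => Ectx.push .inl e.decomp
  | .inr (.val v) => ([], .inr (.val v))
  | .inr e => Ectx.push .inr e.decomp
  | .case (.val v) x e₁ y e₂ => ([], .case (.val v) x e₁ y e₂)
  | .case e x e₁ y e₂ => Ectx.push (.case x e₁ y e₂) e.decomp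
  | .alloc (.val v) => ([], .alloc (.val v))
  | .alloc e => Ectx.push .alloc e.decomp
  | .load (.val v) => ([], .load (.val v))
  | .load e => Ectx.push .load e.decomp
  | .store (.val v) (.val w) => ([], .store (.val v) (.val w))
  | .store e (.val w) => Ectx.push (.storeL w) e.decomp
  | .store e₁ e₂ => Ectx.push (.storeR e₁) e₂.decomp
  | .rand (.val v) => ([], .rand (.val v))
  | .rand e => Ectx.push .rand e.decomp
  | .allocTape (.val v) => ([], .allocTape (.val v))
  | .allocTape e => Ectx.push .allocTape e.decomp
  | .randT (.val v) (.val w) => ([], .randT (.val v) (.val w))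
  | .randT e (.val w) => Ectx.push (.randTL w) e.decomp
  | .randT e₁ e₂ => Ectx.push (.randTR e₁) e₂.decomp

def UnOp.eval : UnOp → Val → Option Val
  | .not, .bool b => some (.bool (!b))
  | .neg, .int z => some (.int (-z))
  | _, _ => none

/-- Literals, and injections of literals. Two values can be compared with `==` if one of them is
of this form. -/
def Val.Unboxed : Val → Prop
  | .int _ | .bool _ | .unit | .loc _ | .lbl _ => True
  | .inl v | .inr v =>
    match v with
    | .int _ | .bool _ | .unit | .loc _ | .lbl _ => True
    | _ => False
  | _ => False

open Classical in
def BinOp.eval : BinOp → Val → Val → Option Val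
  | .eq, v, w => if v.Unboxed ∨ w.Unboxed then some (.bool (decide (v = w))) else none
  | .add, .int a, .int b => some (.int (a + b))
  | .sub, .int a, .int b => some (.int (a - b))
  | .mul, .int a, .int b => some (.int (a * b))
  | .lt, .int a, .int b => some (.bool (decide (a < b)))
  | .le, .int a, .int b => some (.bool (decide (a ≤ b)))
  | _, _, _ => none

/-- A deterministic step to an optional value, stuck if there is none. -/
def retOpt (σ : State) : Option Val → SubDistr Conf
  | some v => SubDistr.ret (.val v, σ)
  | none => SubDistr.zero

/-- `rand N` without recourse to a tape. -/
def uniformStep (N : ℕ) (σ : State) : SubDistr Conf :=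
  SubDistr.map (fun k : Fin (N + 1) => (.val (.int ((k : ℕ) : ℤ)), σ)) (SubDistr.uniform N)

/-- `rand N` labelled with `i`: the first sample on the tape if there is one (and the bound of the
tape is `N`), and otherwise a fresh uniform sample; stuck if there is no tape `i`. -/
def tapeStep (N : ℕ) (i : Label) (σ : State) : SubDistr Conf :=
  match σ.tapes.lookup i with
  | none => SubDistr.zero
  | some ⟨_, []⟩ => uniformStep N σ
  | some ⟨B, k :: ks⟩ =>
    if B = N then
      SubDistr.ret (.val (.int ((k : ℕ) : ℤ)), { σ with tapes := σ.tapes.insert i ⟨B, ks⟩ })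
    else uniformStep N σ

/-- Reduction of a redex; the zero sub-distribution if the expression is not a redex. -/
def headStep : Expr → State → SubDistr Conf
  | .unop op (.val v), σ => retOpt σ (op.eval v)
  | .binop op (.val v) (.val w), σ => retOpt σ (op.eval v w)
  | .app (.val (.recV f x e)) (.val v), σ =>
      SubDistr.ret ((e.substB x v).substB f (.recV f x e), σ)
  | .ite (.val (.bool b)) e₁ e₂, σ => SubDistr.ret (if b then e₁ else e₂, σ)
  | .pair (.val v) (.val w), σ => SubDistr.ret (.val (.pair v w), σ)
  | .fst (.val (.pair v _)), σ => SubDistr.ret (.val v, σ)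
  | .snd (.val (.pair _ w)), σ => SubDistr.ret (.val w, σ)
  | .inl (.val v), σ => SubDistr.ret (.val (.inl v), σ)
  | .inr (.val v), σ => SubDistr.ret (.val (.inr v), σ)
  | .case (.val (.inl v)) x e₁ _ _, σ => SubDistr.ret (e₁.substB x v, σ)
  | .case (.val (.inr v)) _ _ y e₂, σ => SubDistr.ret (e₂.substB y v, σ)
  | .alloc (.val v), σ =>
      SubDistr.ret (.val (.loc (freshKey σ.heap)),
        { σ with heap := σ.heap.insert (freshKey σ.heap) v })
  | .load (.val (.loc l)), σ => retOpt σ (σ.heap.lookup l)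
  | .store (.val (.loc l)) (.val w), σ =>
      match σ.heap.lookup l with
      | some _ => SubDistr.ret (.val .unit, { σ with heap := σ.heap.insert l w })
      | none => SubDistr.zero
  | .rand (.val (.int (.ofNat N))), σ => uniformStep N σ
  | .allocTape (.val (.int (.ofNat N))), σ =>
      SubDistr.ret (.val (.lbl (freshKey σ.tapes)),
        { σ with tapes := σ.tapes.insert (freshKey σ.tapes) ⟨N, []⟩ })
  | .randT (.val (.int (.ofNat N))) (.val (.lbl i)), σ => tapeStep N i σ
  | _, _ => SubDistr.zero

/-- One step of a configuration: reduce the redex inside its evaluation context. -/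
def primStep (ρ : Conf) : SubDistr Conf :=
  SubDistr.map (fun ρ' => (ρ.1.decomp.1.fill ρ'.1, ρ'.2)) (headStep ρ.1.decomp.2 ρ.2)

/-- The Markov chain of program configurations; the final ones are those of values. -/
def langChain : MarkovChain Conf where
  step := primStep
  isFinal ρ := ρ.1.IsVal
  final_step := by
    rintro ⟨_, σ⟩ ⟨v, rfl⟩ s'
    simp [primStep, Expr.decomp, headStep, SubDistr.map, SubDistr.bind, SubDistr.zero]

/-- Presampling: append a uniform sample to the end of the tape `i`. -/
def stateStep (σ : State) (i : Label) : SubDistr State :=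
  match σ.tapes.lookup i with
  | none => SubDistr.zero
  | some ⟨N, ks⟩ =>
    SubDistr.map (fun k => { σ with tapes := σ.tapes.insert i ⟨N, ks ++ [k]⟩ })
      (SubDistr.uniform N)

/-- Monadic fold of `stateStep` over a list of labels. -/
def foldStateStep (σ : State) : List Label → SubDistr State
  | [] => SubDistr.ret σ
  | i :: l => (stateStep σ i).bind fun σ' => foldStateStep σ' l

/-! ## Resource algebras -/

/-- Unital resource algebras. The composition and its unit are those of the commutative monoid, and
the extension order is divisibility. -/
class ResourceAlgebra (M : Type*) extends CommMonoid M where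
  valid : M → Prop
  core : M → M
  core_mul : ∀ a : M, core a * a = a
  core_idem : ∀ a : M, core (core a) = core a
  core_mono : ∀ a b : M, a ∣ b → core a ∣ core b
  core_one : core 1 = 1
  valid_one : valid 1
  valid_of_mul : ∀ a b : M, valid (a * b) → valid a

open ResourceAlgebra

/-- The exclusive resource algebra with a unit. -/
inductive Excl (A : Type*)
  | none
  | ex (a : A)
  | bot

namespace Excl

variable {A : Type*}

def op : Excl A → Excl A → Excl A
  | .none, y => y
  | x, .none => x
  | _, _ => .bot

def Valid : Excl A → Prop
  | .bot => False
  | _ => True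

instance : ResourceAlgebra (Excl A) where
  mul := op
  one := .none
  mul_assoc a b c := by cases a <;> cases b <;> cases c <;> rfl
  one_mul a := by cases a <;> rfl
  mul_one a := by cases a <;> rfl
  mul_comm a b := by cases a <;> cases b <;> rfl
  valid := Valid
  core _ := .none
  core_mul a := by cases a <;> rfl
  core_idem _ := rfl
  core_mono _ _ _ := ⟨.none, rfl⟩
  core_one := rfl
  valid_one := trivial
  valid_of_mul a b h := by cases a <;> cases b <;> first | exact h | trivial

end Excl

instance {M N : Type*} [ResourceAlgebra M] [ResourceAlgebra N] : ResourceAlgebra (M × N) where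
  valid a := valid a.1 ∧ valid a.2
  core a := (core a.1, core a.2)
  core_mul a := Prod.ext (core_mul a.1) (core_mul a.2)
  core_idem a := Prod.ext (core_idem a.1) (core_idem a.2)
  core_mono := by
    rintro a _ ⟨c, rfl⟩
    obtain ⟨x, hx⟩ := core_mono a.1 (a.1 * c.1) ⟨c.1, rfl⟩
    obtain ⟨y, hy⟩ := core_mono a.2 (a.2 * c.2) ⟨c.2, rfl⟩
    exact ⟨(x, y), Prod.ext hx hy⟩
  core_one := Prod.ext core_one core_one
  valid_one := ⟨valid_one, valid_one⟩
  valid_of_mul a b h := ⟨valid_of_mul a.1 b.1 h.1, valid_of_mul a.2 b.2 h.2⟩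

instance {I M : Type*} [ResourceAlgebra M] : ResourceAlgebra (I → M) where
  valid a := ∀ i, valid (a i)
  core a := fun i => core (a i)
  core_mul a := funext fun i => core_mul (a i)
  core_idem a := funext fun i => core_idem (a i)
  core_mono := by
    rintro a _ ⟨c, rfl⟩
    choose x hx using fun i => core_mono (a i) (a i * c i) ⟨c i, rfl⟩
    exact ⟨x, funext hx⟩
  core_one := funext fun _ => core_one
  valid_one := fun _ => valid_one
  valid_of_mul a b h := fun i => valid_of_mul (a i) (b i) (h i)

/-- The authoritative resource algebra. -/
@[ext] structure Auth (A : Type*) where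
  auth : Excl A
  frag : A

namespace Auth

variable {A : Type*} [ResourceAlgebra A]

/-- The fragments must be included in the authoritative element, if there is one. -/
def Valid (x : Auth A) : Prop :=
  match x.auth with
  | .none => valid x.frag
  | .ex a => x.frag ∣ a ∧ valid a
  | .bot => False

instance : ResourceAlgebra (Auth A) where
  mul x y := ⟨x.auth * y.auth, x.frag * y.frag⟩
  one := ⟨1, 1⟩
  mul_assoc a b c := Auth.ext (mul_assoc _ _ _) (mul_assoc _ _ _)
  one_mul a := Auth.ext (one_mul _) (one_mul _)
  mul_one a := Auth.ext (mul_one _) (mul_one _)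
  mul_comm a b := Auth.ext (mul_comm _ _) (mul_comm _ _)
  valid := Valid
  core x := ⟨1, core x.frag⟩
  core_mul x := Auth.ext (one_mul _) (core_mul _)
  core_idem x := Auth.ext rfl (core_idem _)
  core_mono := by
    rintro a _ ⟨c, rfl⟩
    obtain ⟨x, hx⟩ := core_mono a.frag (a.frag * c.frag) ⟨c.frag, rfl⟩
    exact ⟨⟨1, x⟩, Auth.ext rfl hx⟩
  core_one := Auth.ext rfl core_one
  valid_one := by exact (valid_one : valid (1 : A))
  valid_of_mul := by
    rintro ⟨a, x⟩ ⟨b, y⟩ h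
    change Valid ⟨a * b, x * y⟩ at h
    have key : ∀ c : A, x * y ∣ c → valid c → valid x := by
      rintro _ ⟨d, rfl⟩ hc
      exact valid_of_mul x (y * d) (by rwa [← mul_assoc])
    cases a <;> cases b
    · exact valid_of_mul x y h
    · exact key _ h.1 h.2
    · exact h.elim
    · exact ⟨(Dvd.intro y rfl).trans h.1, h.2⟩
    all_goals exact h.elim

/-- The authoritative element. -/
def full (a : A) : Auth A := ⟨.ex a, 1⟩

/-- The fragment. -/
def part (b : A) : Auth A := ⟨.none, b⟩

end Auth

/-! ## The base logic: step-indexed predicates over a resource algebra -/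

/-- Propositions: predicates on step indices and resources, closed under smaller indices and
larger resources. -/
structure UPred (M : Type*) [ResourceAlgebra M] where
  holds : ℕ → M → Prop
  mono : ∀ {n m : ℕ} {a b : M}, holds n a → a ∣ b → m ≤ n → holds m b

namespace UPred

variable {M : Type*} [ResourceAlgebra M]

/-- Entailment `P ⊢ Q`. -/
def Entails (P Q : UPred M) : Prop := ∀ n a, valid a → P.holds n a → Q.holds n a

def pure (φ : Prop) : UPred M := ⟨fun _ _ => φ, fun h _ _ => h⟩

/-- `⊢ P`. -/
def Provable (P : UPred M) : Prop := Entails (pure True) P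

def or (P Q : UPred M) : UPred M :=
  ⟨fun n a => P.holds n a ∨ Q.holds n a,
    fun h hab hm => h.imp (fun h => P.mono h hab hm) fun h => Q.mono h hab hm⟩

def all {I : Sort*} (P : I → UPred M) : UPred M :=
  ⟨fun n a => ∀ i, (P i).holds n a, fun h hab hm i => (P i).mono (h i) hab hm⟩

def ex {I : Sort*} (P : I → UPred M) : UPred M :=
  ⟨fun n a => ∃ i, (P i).holds n a, fun ⟨i, h⟩ hab hm => ⟨i, (P i).mono h hab hm⟩⟩

/-- Separating conjunction. -/
def sep (P Q : UPred M) : UPred M :=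
  ⟨fun n a => ∃ a₁ a₂, a = a₁ * a₂ ∧ P.holds n a₁ ∧ Q.holds n a₂, by
    rintro n m _ _ ⟨a₁, a₂, rfl, h₁, h₂⟩ ⟨c, rfl⟩ hm
    exact ⟨a₁, a₂ * c, mul_assoc _ _ _, P.mono h₁ dvd_rfl hm, Q.mono h₂ (Dvd.intro c rfl) hm⟩⟩

/-- Separating implication (magic wand). -/
def wand (P Q : UPred M) : UPred M :=
  ⟨fun n a => ∀ m ≤ n, ∀ b, valid (a * b) → P.holds m b → Q.holds m (a * b), by
    rintro n k a _ h ⟨c, rfl⟩ hk m hm b hv hP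
    have e : a * c * b = a * b * c := mul_right_comm _ _ _
    refine Q.mono (h m (hm.trans hk) b (valid_of_mul _ c (e ▸ hv)) hP) ⟨c, e⟩ le_rfl⟩

/-- The later modality `▷ P`. -/
def later (P : UPred M) : UPred M :=
  ⟨fun n a => ∀ m < n, P.holds m a,
    fun h hab hm k hk => P.mono (h k (hk.trans_le hm)) hab le_rfl⟩

/-- The persistence modality `□ P`. -/
def always (P : UPred M) : UPred M :=
  ⟨fun n a => P.holds n (core a), fun h hab hm => P.mono h (core_mono _ _ hab) hm⟩

/-- Ownership of a resource. -/
def own (r : M) : UPred M := ⟨fun _ a => r ∣ a, fun h hab _ => h.trans hab⟩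

/-- The (basic) update modality: a frame-preserving update of the owned resources. -/
def bupd (P : UPred M) : UPred M :=
  ⟨fun n a => ∀ m ≤ n, ∀ c, valid (a * c) → ∃ b, valid (b * c) ∧ P.holds m b, by
    rintro n k a _ h ⟨d, rfl⟩ hk m hm c hv
    obtain ⟨b, hb, hP⟩ := h m (hm.trans hk) (d * c) (by rwa [← mul_assoc])
    exact ⟨b * d, by rwa [mul_assoc], P.mono hP (Dvd.intro d rfl) le_rfl⟩⟩

/-- The least fixed point of a monotone operator on families of propositions, as the intersection
of all its pre-fixed points (Knaster–Tarski). -/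
def lfp {I : Type*} (F : (I → UPred M) → I → UPred M) (i : I) : UPred M :=
  ⟨fun n a => ∀ Φ : I → UPred M, (∀ j, Entails (F Φ j) (Φ j)) → (Φ i).holds n a,
    fun h hab hm Φ hΦ => (Φ i).mono (h Φ hΦ) hab hm⟩

end UPred

/-! ## The refinement logic -/

/-- The resources: the state of the model, the heap, and the presampling tapes, each with an
authoritative view. -/
abbrev Res (S : Type*) :=
  Auth (Excl S) × Auth (Loc → Excl Val) × Auth (Label → Excl Tape)

abbrev IProp (S : Type*) := UPred (Res S)

/-- A finite map as a family of exclusive resources. -/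
def toExcl {V : Type*} (m : Finmap fun _ : ℕ => V) (k : ℕ) : Excl V :=
  match m.lookup k with
  | some v => .ex v
  | none => .none

section Logic

variable {S : Type*}

open UPred

/-- `spec(m)`: the model is in state `m`. -/
def spec (m : S) : IProp S := own (Auth.part (.ex m), 1, 1)

/-- The model interpretation. -/
def specInterp (m : S) : IProp S := own (Auth.full (.ex m), 1, 1)

/-- The state interpretation. -/
def stateInterp (σ : State) : IProp S :=
  own (1, Auth.full (toExcl σ.heap), Auth.full (toExcl σ.tapes))

variable (M : MarkovChain S)

/-- The operator whose least fixed point is the coupling precondition. The four disjuncts are a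
step of the program, a coupled step of model and program, a step of the model, and a step of the
model coupled with presampling onto tapes. -/
def execCouplPre (B : S × Conf → IProp S) (C : S × Conf → IProp S) (s : S × Conf) : IProp S :=
  let m := s.1
  let ρ := s.2
  or (ex fun R : S → Conf → Prop =>
      sep (pure (langChain.Red ρ ∧ SubDistr.RCoupl (SubDistr.ret m) (langChain.step ρ) R))
        (all fun t : {t : S × Conf // R t.1 t.2} => B t.1))
  (or (ex fun R : S → Conf → Prop =>
      sep (pure (langChain.Red ρ ∧ M.Red m ∧
          SubDistr.RCoupl (M.step m) (langChain.step ρ) R))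
        (all fun t : {t : S × Conf // R t.1 t.2} => later (B t.1)))
  (or (ex fun R : S → Conf → Prop =>
      sep (pure (M.Red m ∧ SubDistr.RCoupl (M.step m) (SubDistr.ret ρ) R))
        (all fun m' : {m' : S // R m' ρ} => later (C (m'.1, ρ))))
  (ex fun R : S → State → Prop => ex fun l : List Label =>
      sep (pure (M.Red m ∧ (∀ i ∈ l, i ∈ ρ.2.tapes) ∧
          SubDistr.RCoupl (M.step m) (foldStateStep ρ.2 l) R))
        (all fun t : {t : S × State // R t.1 t.2} => later (C (t.1.1, (ρ.1, t.1.2)))))))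

/-- The coupling precondition. -/
def execCoupl (m : S) (ρ : Conf) (B : S × Conf → IProp S) : IProp S :=
  lfp (execCouplPre M B) (m, ρ)

/-- The operator whose least fixed point is the refinement weakest precondition. -/
def rwpPre (Φ : Val → IProp S) (W : Expr → IProp S) (e : Expr) : IProp S :=
  or (ex fun v : Val => sep (pure (e = .val v)) (bupd (Φ v)))
    (sep (pure (¬ e.IsVal))
      (all fun m : S => all fun σ : State =>
        wand (sep (specInterp m) (stateInterp σ))
          (bupd (execCoupl M m (e, σ) fun t =>
            bupd (sep (specInterp t.1) (sep (stateInterp t.2.2) (W t.2.1)))))))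

/-- The refinement weakest precondition. -/
def rwp (e : Expr) (Φ : Val → IProp S) : IProp S := lfp (rwpPre M Φ) e

/-- The Hoare triple `{P} e {v. Φ v} := □ (P -∗ rwp e {Φ})`. -/
def hoare (P : IProp S) (e : Expr) (Φ : Val → IProp S) : IProp S :=
  always (wand P (rwp M e Φ))

end Logic

/-! ## The list generator and its model -/

/-- `λ x. e` -/
def Val.lam (x : Binder) (e : Expr) : Val := .recV none x e

/-- `let x = e₁ in e₂` -/
def Expr.letIn (x : Var) (e₁ e₂ : Expr) : Expr := .app (.val (.lam (some x) e₂)) e₁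

/-- `flip`, i.e. `rand 1 == 1` -/
def Expr.flip : Expr := .binop .eq (.rand (.val (.int 1))) (.val (.int 1))

/-- `None` -/
def Expr.noneE : Expr := .val (.inl .unit)

/-- `Some e` -/
def Expr.someE (e : Expr) : Expr := .inr e

/-- `rec listgen f = if flip then None else let h = f () in let t = listgen f in Some (h, t)`,
where the variables `listgen`, `f`, `h`, `t` have the numbers `0`, `1`, `2`, `3`. -/
def listgen : Val :=
  .recV (some 0) (some 1)
    (.ite .flip .noneE
      (.letIn 2 (.app (.var 1) (.val .unit))
        (.letIn 3 (.app (.var 0) (.var 1))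
          (.someE (.pair (.var 2) (.var 3))))))

/-- `listgen (λ _. flip)` -/
def innerGen : Expr := .app (.val listgen) (.val (.lam none .flip))

/-- `listgen (λ _. listgen (λ _. flip))` -/
def nestedGen : Expr := .app (.val listgen) (.val (.lam none innerGen))

inductive GenState
  | qf | q0 | q1

/-- The transition probabilities of the model. -/
def genProb : GenState → GenState → ℝ≥0∞
  | .q0, .qf => 1 / 2
  | .q0, .q1 => 1 / 2
  | .q1, .q1 => 1 / 2
  | .q1, .q0 => 1 / 2
  | _, _ => 0

theorem sum_genState (f : GenState → ℝ≥0∞) : ∑' s, f s = f .qf + (f .q0 + f .q1) := by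
  classical
  rw [tsum_eq_sum (s := {.qf, .q0, .q1}) (fun s hs => by cases s <;> simp at hs),
    Finset.sum_insert (by simp), Finset.sum_insert (by simp), Finset.sum_singleton]

/-- The three-state Markov chain, with `qf` as its only final state. -/
def genChain : MarkovChain GenState where
  step s := ⟨genProb s, by
    rw [sum_genState]; cases s <;> simp [genProb, ENNReal.inv_two_add_inv_two]⟩
  isFinal s := s = .qf
  final_step := by rintro _ rfl s'; cases s' <;> rfl

/-- The ranking function of the model. -/
def genRank : GenState → ℝ≥0
  | .qf => 0
  | .q0 => 2
  | .q1 => 3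

end Caliper

end

open Caliper

-- The model moves only together with the flip at the head of `listgen`; every other reduction,
-- including the innermost element's flip, leaves it in place. On `false` the model enters the state
-- from which the element function starts, and that function must bring it back before the recursive
-- call; on `true` it moves on and the list ends. For the inner generator the element function stays
-- at `q1`; for the outer one it is the inner generator, which goes from `q1` to `q0`.
--
-- This argument is made once, for any judgement `G n e m` closed under the two rules of
-- `RefinementRules`: a silent step keeps the index, a coupled one asks for its successors only at
-- smaller indices. Strong induction on the index, in the role of Löb induction, gives
-- `RefinementRules.listgen_moves`.
--
-- The rules have two instances. `SpecEntails W`, for an arbitrary pre-fixed point `W` of the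
-- weakest precondition operator, yields the triples and the refinement. `TermRefines`, whose index
-- bounds the number of model steps, yields the termination inequality directly, without an adequacy
-- theorem for the logic. The model terminates almost surely because its hitting probabilities solve
-- a linear system whose only finite solution is 1.

namespace Caliper

open ResourceAlgebra

-- Expectations, push-forwards and couplings.

namespace SubDistr

variable {A B C : Type*}

/-- The expected value of a function under a sub-distribution. -/
noncomputable def expect (μ : SubDistr A) (f : A → ℝ≥0∞) : ℝ≥0∞ := ∑' a, μ.mass a * f a

@[ext] theorem ext {μ ν : SubDistr A} (h : ∀ a, μ.mass a = ν.mass a) : μ = ν := by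
  cases μ; cases ν; congr; exact funext h

theorem expect_ret (a : A) (f : A → ℝ≥0∞) : (ret a).expect f = f a := by
  classical
  unfold expect
  rw [tsum_eq_single a (fun b hb => by simp [ret, hb])]
  simp [ret]

theorem expect_bind (μ : SubDistr A) (k : A → SubDistr B) (f : B → ℝ≥0∞) :
    (bind μ k).expect f = μ.expect fun a => (k a).expect f := by
  simp only [expect, bind, ← ENNReal.tsum_mul_left, ← ENNReal.tsum_mul_right]
  rw [ENNReal.tsum_comm]
  simp only [mul_assoc]

theorem expect_map (g : A → B) (μ : SubDistr A) (f : B → ℝ≥0∞) :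
    (map g μ).expect f = μ.expect (f ∘ g) := by
  simp only [map, expect_bind, expect_ret, Function.comp_def]

theorem expect_mono (μ : SubDistr A) {f g : A → ℝ≥0∞} (h : ∀ a, f a ≤ g a) :
    μ.expect f ≤ μ.expect g :=
  ENNReal.tsum_le_tsum fun a => mul_le_mul_right (h a) _

-- Expectations of indicators determine masses, so identities between push-forwards reduce to
-- `expect_map`.
open Classical in
theorem mass_eq_expect (μ : SubDistr A) (a : A) :
    μ.mass a = μ.expect fun b => if b = a then 1 else 0 := by
  unfold expect
  rw [tsum_eq_single a (fun b hb => by simp [hb])]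
  simp

theorem map_map (g : A → B) (h : B → C) (μ : SubDistr A) :
    map h (map g μ) = map (h ∘ g) μ := by
  ext c
  simp only [mass_eq_expect, expect_map, Function.comp_assoc]

theorem tsum_mass_uniform (N : ℕ) : ∑' k, (uniform N).mass k = 1 := by
  rw [tsum_fintype]
  simp only [uniform, Finset.sum_const, Finset.card_univ, Fintype.card_fin, nsmul_eq_mul]
  push_cast
  rw [ENNReal.mul_inv_cancel (by simp) (by finiteness)]

/-- Lets a deterministic move, of program or model, be treated as an image of a uniform sample, so
that `rcoupl_map` covers every coupling needed. -/
theorem map_const_uniform (N : ℕ) (a : A) : map (fun _ => a) (uniform N) = ret a := by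
  ext b
  rw [mass_eq_expect, expect_map, mass_eq_expect, expect_ret]
  simp only [expect, Function.comp_apply, ENNReal.tsum_mul_right, tsum_mass_uniform, one_mul]

theorem map_mass_pos (g : A → B) (μ : SubDistr A) {a : A} (h : 0 < μ.mass a) :
    0 < (map g μ).mass (g a) :=
  calc 0 < μ.mass a * (ret (g a)).mass (g a) := by simpa [ret] using h
    _ ≤ _ := ENNReal.le_tsum (f := fun a' => μ.mass a' * (ret (g a')).mass (g a)) a

theorem exists_of_map_mass_pos (g : A → B) (μ : SubDistr A) {b : B} (h : 0 < (map g μ).mass b) :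
    ∃ a, g a = b := by
  by_contra! hb
  refine h.ne' (ENNReal.tsum_eq_zero.2 fun a => ?_)
  simp [ret, (hb a).symm]

theorem uniform_mass_pos (N : ℕ) (k : Fin (N + 1)) : 0 < (uniform N).mass k := by
  simp only [uniform, ENNReal.inv_pos]
  finiteness

theorem tsum_mass_fst (μ : SubDistr (A × B)) (a : A) :
    ∑' b, μ.mass (a, b) = (map Prod.fst μ).mass a := by
  classical
  rw [mass_eq_expect, expect_map, expect, ENNReal.tsum_prod',
    tsum_eq_single a (fun b hb => by simp [hb])]
  simp

theorem tsum_mass_snd (μ : SubDistr (A × B)) (b : B) :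
    ∑' a, μ.mass (a, b) = (map Prod.snd μ).mass b := by
  classical
  rw [mass_eq_expect, expect_map, expect, ENNReal.tsum_prod', ENNReal.tsum_comm,
    tsum_eq_single b (fun b' hb => by simp [hb])]
  simp

/-- Two images of the same sub-distribution are coupled along it. -/
theorem rcoupl_map (μ : SubDistr C) (f : C → A) (g : C → B) (R : A → B → Prop)
    (h : ∀ c, R (f c) (g c)) : RCoupl (map f μ) (map g μ) R := by
  refine ⟨map (fun c => (f c, g c)) μ, fun a => ?_, fun b => ?_, fun a b hab => ?_⟩
  · rw [tsum_mass_fst, map_map]; rfl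
  · rw [tsum_mass_snd, map_map]; rfl
  · obtain ⟨c, hc⟩ := exists_of_map_mass_pos _ _ hab
    cases hc
    exact h c

end SubDistr

-- Termination probabilities.

namespace MarkovChain

variable {S : Type*} (M : MarkovChain S)

theorem tsum_iSup_of_monotone {A : Type*} {f : ℕ → A → ℝ≥0∞} (hf : ∀ a, Monotone fun n => f n a) :
    ∑' a, ⨆ n, f n a = ⨆ n, ∑' a, f n a := by
  simp only [ENNReal.tsum_eq_iSup_sum]
  rw [iSup_comm]
  exact iSup_congr fun F => ENNReal.finsetSum_iSup_of_monotone hf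

/-- The probability of termination within `n` steps. -/
noncomputable def termN (n : ℕ) (s : S) : ℝ≥0∞ := ∑' s', (M.execN n s).mass s'

theorem termN_mono (s : S) : Monotone fun n => M.termN n s := fun _ _ h =>
  ENNReal.tsum_le_tsum fun s' => M.execN_mono s s' h

theorem termN_le_one (n : ℕ) (s : S) : M.termN n s ≤ 1 := (M.execN n s).tsum_le_one

theorem execTerm_eq_iSup (s : S) : M.execTerm s = ⨆ n, M.termN n s :=
  tsum_iSup_of_monotone (M.execN_mono s)

theorem execTerm_le_one (s : S) : M.execTerm s ≤ 1 := (M.exec s).tsum_le_one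

theorem tsum_mass_eq_expect {A : Type*} (μ : SubDistr A) : ∑' a, μ.mass a = μ.expect 1 := by
  simp [SubDistr.expect]

theorem termN_of_final {s : S} (h : M.isFinal s) (n : ℕ) : M.termN n s = 1 := by
  rw [termN, tsum_mass_eq_expect]
  cases n <;> simp [execN, h, SubDistr.expect_ret]

theorem termN_zero {s : S} (h : ¬ M.isFinal s) : M.termN 0 s = 0 := by
  simp [termN, execN, h, SubDistr.zero]

theorem termN_succ {s : S} (h : ¬ M.isFinal s) (n : ℕ) :
    M.termN (n + 1) s = (M.step s).expect (M.termN n) := by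
  rw [termN, tsum_mass_eq_expect, execN, if_neg h, SubDistr.expect_bind]
  congr 1
  exact funext fun s' => (tsum_mass_eq_expect _).symm

theorem execTerm_of_final {s : S} (h : M.isFinal s) : M.execTerm s = 1 := by
  simp [execTerm_eq_iSup, termN_of_final M h]

/-- Monotone convergence applied to the one-step recursion of `termN`; dropping the zeroth term
leaves the supremum unchanged. -/
theorem execTerm_eq_expect {s : S} (h : ¬ M.isFinal s) :
    M.execTerm s = (M.step s).expect M.execTerm := by
  rw [execTerm_eq_iSup, ← (M.termN_mono s).iSup_nat_add 1]
  simp only [M.termN_succ h, SubDistr.expect]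
  rw [← tsum_iSup_of_monotone (f := fun n s' => (M.step s).mass s' * M.termN n s')
    fun s' n k hnk => mul_le_mul_right (M.termN_mono s' hnk) _]
  simp only [execTerm_eq_iSup, ENNReal.mul_iSup]

theorem not_isFinal_of_red {s : S} (h : M.Red s) : ¬ M.isFinal s := fun hf =>
  let ⟨s', hs⟩ := h
  hs.ne' (M.final_step s hf s')

theorem red_of_step_eq_map {N : ℕ} {s : S} {f : Fin (N + 1) → S}
    (h : M.step s = SubDistr.map f (SubDistr.uniform N)) : M.Red s :=
  ⟨f 0, h ▸ SubDistr.map_mass_pos f _ (SubDistr.uniform_mass_pos N 0)⟩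

end MarkovChain

-- Evaluation contexts and uniform program steps.

theorem Expr.decomp_fillItem (Ki : EctxItem) {e : Expr} (h : ¬ e.IsVal) :
    (Ki.fill e).decomp = Ectx.push Ki e.decomp := by
  cases e with
  | val v => exact (h ⟨v, rfl⟩).elim
  | _ => cases Ki <;> simp only [EctxItem.fill, Expr.decomp]

theorem EctxItem.not_isVal_fill (Ki : EctxItem) (e : Expr) : ¬ (Ki.fill e).IsVal := by
  rintro ⟨v, hv⟩
  cases Ki <;> simp [EctxItem.fill] at hv

theorem Ectx.not_isVal_fill (K : Ectx) {e : Expr} (h : ¬ e.IsVal) : ¬ (K.fill e).IsVal := by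
  cases K with
  | nil => exact h
  | cons Ki K => exact Ki.not_isVal_fill _

theorem Ectx.decomp_fill (K : Ectx) {e : Expr} (h : ¬ e.IsVal) :
    (K.fill e).decomp = (K ++ e.decomp.1, e.decomp.2) := by
  induction K with
  | nil => rfl
  | cons Ki K ih =>
    change (Ki.fill (Ectx.fill K e)).decomp = _
    rw [Expr.decomp_fillItem Ki (Ectx.not_isVal_fill K h), ih]
    rfl

theorem Ectx.fill_append (K K' : Ectx) (e : Expr) : Ectx.fill (K ++ K') e = K.fill (K'.fill e) :=
  List.foldr_append

/-- From every state, the expression reduces to one of the `e' k`, uniformly. -/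
def Expr.StepsUniform {N : ℕ} (e : Expr) (e' : Fin (N + 1) → Expr) : Prop :=
  ∀ σ, primStep (e, σ) = SubDistr.map (fun k => (e' k, σ)) (SubDistr.uniform N)

theorem Expr.StepsUniform.red {N : ℕ} {e : Expr} {e' : Fin (N + 1) → Expr} (h : e.StepsUniform e')
    (σ : State) : langChain.Red (e, σ) :=
  langChain.red_of_step_eq_map (h σ)

theorem Expr.StepsUniform.not_isVal {N : ℕ} {e : Expr} {e' : Fin (N + 1) → Expr}
    (h : e.StepsUniform e') : ¬ e.IsVal :=
  langChain.not_isFinal_of_red (h.red ⟨∅, ∅⟩)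

theorem Ectx.stepsUniform_fill {N : ℕ} (K : Ectx) {e : Expr} {e' : Fin (N + 1) → Expr}
    (hd : e.decomp = ([], e)) (hv : ¬ e.IsVal)
    (h : ∀ σ, headStep e σ = SubDistr.map (fun k => (e' k, σ)) (SubDistr.uniform N)) :
    (K.fill e).StepsUniform fun k => K.fill (e' k) := by
  intro σ
  simp only [primStep, K.decomp_fill hv, hd, h, SubDistr.map_map, List.append_nil]
  rfl

theorem Ectx.stepsUniform_fill_of_ret (K : Ectx) {e e' : Expr}
    (hd : e.decomp = ([], e)) (hv : ¬ e.IsVal) (h : ∀ σ, headStep e σ = SubDistr.ret (e', σ)) :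
    (K.fill e).StepsUniform fun _ : Fin 1 => K.fill e' :=
  K.stepsUniform_fill hd hv fun σ => by rw [h, SubDistr.map_const_uniform]

-- Abstract refinement judgements and their derived rules.

/-- The rules for a step-indexed judgement `G n e m` that the expression `e` refines the state `m`
of the model: a step of the program on its own, and a coupled step, which uses up an index. -/
structure RefinementRules {S : Type*} (M : MarkovChain S) (G : ℕ → Expr → S → Prop) : Prop where
  silent : ∀ {N n : ℕ} {e : Expr} {e' : Fin (N + 1) → Expr} {m : S}, e.StepsUniform e' →
    (∀ k, G n (e' k) m) → G n e m
  coupled : ∀ {N n : ℕ} {e : Expr} {e' : Fin (N + 1) → Expr} {m : S} (f : Fin (N + 1) → S),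
    e.StepsUniform e' → M.step m = SubDistr.map f (SubDistr.uniform N) →
    (∀ k, ∀ i < n, G i (e' k) (f k)) → G n e m

namespace RefinementRules

variable {S : Type*} {M : MarkovChain S} {G : ℕ → Expr → S → Prop}

theorem pure (hG : RefinementRules M G) {n : ℕ} {m : S} (K : Ectx) {e e' : Expr}
    (hd : e.decomp = ([], e)) (hv : ¬ e.IsVal) (h : ∀ σ, headStep e σ = SubDistr.ret (e', σ))
    (h' : G n (K.fill e') m) : G n (K.fill e) m :=
  hG.silent (K.stepsUniform_fill_of_ret hd hv h) fun _ => h'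

theorem beta (hG : RefinementRules M G) {n : ℕ} {m : S} (K : Ectx) {f x : Binder} {e : Expr}
    {v : Val} (h : G n (K.fill ((e.substB x v).substB f (.recV f x e))) m) :
    G n (K.fill (.app (.val (.recV f x e)) (.val v))) m :=
  hG.pure K (by simp only [Expr.decomp]) (by rintro ⟨_, h⟩; cases h)
    (fun σ => by simp only [headStep]) h

theorem stepsUniform_rand_one (K : Ectx) :
    (K.fill (.rand (.val (.int 1)))).StepsUniform
      fun k : Fin 2 => K.fill (.val (.int ((k : ℕ) : ℤ))) :=
  K.stepsUniform_fill (by simp only [Expr.decomp]) (by rintro ⟨_, h⟩; cases h) fun σ => by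
    -- The defining equation of `headStep` matches the bound only as `Int.ofNat`.
    change headStep (.rand (.val (.int (.ofNat 1)))) σ = _
    simp only [headStep, uniformStep]

theorem eq_one (hG : RefinementRules M G) {n : ℕ} {m : S} (K : Ectx) (k : ℤ)
    (h : G n (K.fill (.val (.bool (decide (k = 1))))) m) :
    G n (K.fill (.binop .eq (.val (.int k)) (.val (.int 1)))) m :=
  hG.pure K (by simp only [Expr.decomp]) (by rintro ⟨_, h⟩; cases h)
    (fun σ => by simp [headStep, BinOp.eval, Val.Unboxed, retOpt]) h

theorem flip (hG : RefinementRules M G) {n : ℕ} {m : S} (K : Ectx)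
    (h : ∀ b, G n (K.fill (.val (.bool b))) m) : G n (K.fill .flip) m := by
  have h1 := stepsUniform_rand_one (K ++ [.binopL .eq (.int 1)])
  simp only [Ectx.fill_append] at h1
  exact hG.silent h1 fun k => hG.eq_one K _ (h _)

/-- The model moves at the sampling step, where the index drops; the comparison with 1 is silent and
turns sample 0 into `false`, sample 1 into `true`. -/
theorem flip_coupled (hG : RefinementRules M G) {n : ℕ} {m : S} (K : Ectx) (f : Fin 2 → S)
    (hf : M.step m = SubDistr.map f (SubDistr.uniform 1))
    (h0 : ∀ i < n, G i (K.fill (.val (.bool false))) (f 0))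
    (h1 : ∀ i < n, G i (K.fill (.val (.bool true))) (f 1)) : G n (K.fill .flip) m := by
  have hs := stepsUniform_rand_one (K ++ [.binopL .eq (.int 1)])
  simp only [Ectx.fill_append] at hs
  refine hG.coupled f hs hf fun k i hi => hG.eq_one K _ ?_
  fin_cases k
  · exact h0 i hi
  · exact h1 i hi

theorem ite (hG : RefinementRules M G) {n : ℕ} {m : S} (K : Ectx) (b : Bool) {e₁ e₂ : Expr}
    (h : G n (K.fill (if b then e₁ else e₂)) m) :
    G n (K.fill (.ite (.val (.bool b)) e₁ e₂)) m :=
  hG.pure K (by simp only [Expr.decomp]) (by rintro ⟨_, h⟩; cases h)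
    (fun σ => by simp only [headStep]) h

theorem pair (hG : RefinementRules M G) {n : ℕ} {m : S} (K : Ectx) {v w : Val}
    (h : G n (K.fill (.val (.pair v w))) m) : G n (K.fill (.pair (.val v) (.val w))) m :=
  hG.pure K (by simp only [Expr.decomp]) (by rintro ⟨_, h⟩; cases h)
    (fun σ => by simp only [headStep]) h

theorem inr (hG : RefinementRules M G) {n : ℕ} {m : S} (K : Ectx) {v : Val}
    (h : G n (K.fill (.val (.inr v))) m) : G n (K.fill (.inr (.val v))) m :=
  hG.pure K (by simp only [Expr.decomp]) (by rintro ⟨_, h⟩; cases h)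
    (fun σ => by simp only [headStep]) h

end RefinementRules

-- The list generator under an abstract judgement.

/-- In every evaluation context, `e` brings the model from `m` to `m'`, whatever value it returns. -/
def Expr.Moves {S : Type*} (G : ℕ → Expr → S → Prop) (e : Expr) (m m' : S) : Prop :=
  ∀ (n : ℕ) (K : Ectx), (∀ (v : Val), ∀ i ≤ n, G i (K.fill (.val v)) m') → G n (K.fill e) m

theorem subst_listgen (z : Var) (u : Val) : Val.subst z u listgen = listgen := by
  by_cases h0 : z = 0 <;> by_cases h1 : z = 1 <;> by_cases h2 : z = 2 <;> by_cases h3 : z = 3 <;>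
  simp [listgen, Val.subst, Expr.subst, Expr.flip, Expr.noneE, Expr.someE, Expr.letIn, Val.lam,
    h0, h1, h2, h3, eq_comm (b := z)]

theorem Ectx.fill_concat (K : Ectx) (Ki : EctxItem) (e : Expr) :
    Ectx.fill (K ++ [Ki]) e = K.fill (Ki.fill e) :=
  K.fill_append [Ki] e

/-- The model state `m` is the loop invariant: `false` leads to `m'`, from which `hfun` returns to
`m` for the recursive call, and `true` exits to `m''`. The flip has lowered the index by then, so
the induction hypothesis applies to that call. Closedness of `f` keeps it intact under the
substitutions. -/
theorem RefinementRules.listgen_moves {S : Type*} {M : MarkovChain S} {G : ℕ → Expr → S → Prop}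
    (hG : RefinementRules M G) {f : Val} (hf : ∀ z u, Val.subst z u f = f) {m m' m'' : S}
    (hm : M.step m = SubDistr.map ![m', m''] (SubDistr.uniform 1))
    (hfun : Expr.Moves G (.app (.val f) (.val .unit)) m' m) :
    Expr.Moves G (.app (.val listgen) (.val f)) m m'' := by
  intro n
  induction n using Nat.strong_induction_on with
  | _ n ih =>
  intro K hK
  refine hG.beta K ?_
  rw [← listgen]
  simp only [Expr.substB, Expr.subst, Expr.flip, Expr.noneE, Expr.someE, Expr.letIn, Val.lam,
    Val.subst, hf, if_true]
  simp (disch := decide) only [Option.some.injEq, reduceCtorEq, false_or, if_neg]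
  rw [← Expr.flip]
  -- The conditional around the flip is absorbed into the evaluation context; the calls below are
  -- focused in the same way.
  refine (congrArg (fun e => G n e m) (Ectx.fill_concat K (.ite _ _) _)).mp
    (hG.flip_coupled (K ++ [.ite _ _]) _ hm (fun i hi => ?_) fun i hi => ?_)
  · rw [Ectx.fill_concat]
    refine hG.ite K _ ?_
    simp only [Bool.false_eq_true, if_false]
    refine (congrArg (fun e => G i e _) (Ectx.fill_concat K (.appR _) _)).mp
      (hfun i _ fun h j hj => ?_)
    rw [Ectx.fill_concat]
    refine hG.beta K ?_
    simp only [Expr.substB, Expr.subst, Val.subst, hf]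
    simp (disch := decide) only [Option.some.injEq, reduceCtorEq, false_or, if_neg, if_true,
      Expr.subst, subst_listgen]
    -- The recursive call runs at `j ≤ i < n`, in the context that still has to bind the tail.
    refine (congrArg (fun e => G j e _) (Ectx.fill_concat K (.appR _) _)).mp
      (ih j (hj.trans_lt hi) _ fun t k hk => ?_)
    rw [Ectx.fill_concat]
    refine hG.beta K ?_
    simp only [Expr.substB, Expr.subst, if_true]
    refine (congrArg (fun e => G k e _) (Ectx.fill_concat K .inr _)).mp (hG.pair _ ?_)
    rw [Ectx.fill_concat]
    -- The index has only decreased, which is why `Expr.Moves` assumes its continuation at all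
    -- indices up to `n`.
    exact hG.inr K (hK _ _ (by omega))
  · rw [Ectx.fill_concat]
    exact hG.ite K _ (hK _ i hi.le)

-- The instance in the logic: resources and weakest preconditions.

open UPred

/-- An exclusive element composed with anything but the unit is `bot`, and no multiple of `bot` is
exclusive. -/
theorem Excl.eq_one_of_ex_mul_dvd {A : Type*} {a b : A} {y : Excl A} (h : .ex a * y ∣ Excl.ex b) :
    a = b ∧ y = 1 := by
  obtain ⟨z, hz⟩ := h
  change Excl.ex b = Excl.op (Excl.op (.ex a) y) z at hz
  cases y <;> cases z <;> simp_all [Excl.op]; rfl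

theorem Excl.eq_one_of_mul_eq_one {A : Type*} {x y : Excl A} (h : x * y = 1) : y = 1 := by
  change Excl.op x y = Excl.none at h
  cases x <;> cases y <;> simp_all [Excl.op]; rfl

/-- The full view and the exclusive fragment agree, and nothing else is owned beside them. -/
theorem Auth.agree {A : Type*} {a b : A} {x : Auth (Excl A)}
    (h : valid (Auth.part (.ex a) * Auth.full (.ex b) * x)) : a = b ∧ x = 1 := by
  obtain ⟨x, y⟩ := x
  have e : Auth.part (.ex a) * Auth.full (.ex b) * (⟨x, y⟩ : Auth (Excl A)) =
      ⟨.ex (.ex b) * x, .ex a * y⟩ := rfl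
  rw [e] at h
  -- A second authoritative component would make the product `bot`.
  have hx : x = 1 := by
    change Auth.Valid _ at h
    cases x
    · rfl
    all_goals exact h.elim
  subst hx
  obtain ⟨rfl, rfl⟩ := Excl.eq_one_of_ex_mul_dvd h.1
  exact ⟨rfl, rfl⟩

theorem Auth.valid_part_mul_full {A : Type*} (a : A) :
    valid (Auth.part (Excl.ex a) * Auth.full (.ex a)) :=
  ⟨dvd_rfl, trivial⟩

theorem Auth.eq_one_of_mul_eq_one {A : Type*} {x y : Auth (Excl A)} (h : x * y = 1) : y = 1 :=
  Auth.ext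
    (by
      have h1 : x.auth * y.auth = 1 := congrArg Auth.auth h
      exact Excl.eq_one_of_mul_eq_one h1)
    (by
      have h1 : x.frag * y.frag = 1 := congrArg Auth.frag h
      exact Excl.eq_one_of_mul_eq_one h1)

section Logic

variable {S : Type*} {M : MarkovChain S}

/-- The fragment and the full view of the model state, and the full view of the program state. -/
def ownedRes (m : S) (σ : State) : Res S :=
  (Auth.part (.ex m) * Auth.full (.ex m), Auth.full (toExcl σ.heap), Auth.full (toExcl σ.tapes))

/-- The frame-preserving update of the model state: fragment and full view together force the frame
to be trivial in that component. The other components keep the same `σ`, since no step of these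
programs changes it. -/
theorem valid_ownedRes_mul {m m' : S} {σ : State} {x c : Res S} (hx : ownedRes m σ ∣ x)
    (h : valid (x * c)) : valid (ownedRes m' σ * c) := by
  obtain ⟨r, rfl⟩ := hx
  have h1 := h.1
  change valid (Auth.part (.ex m) * Auth.full (.ex m) * r.1 * c.1) at h1
  rw [mul_assoc] at h1
  refine ⟨?_, ?_⟩
  · change valid (Auth.part (.ex m') * Auth.full (.ex m') * c.1)
    rw [Auth.eq_one_of_mul_eq_one (Auth.agree h1).2, mul_one]
    exact Auth.valid_part_mul_full m'
  · rw [mul_right_comm] at h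
    exact (valid_of_mul _ _ h).2

/-- The assertion `W e` follows at index `n` from ownership of the model state `m`. -/
def SpecEntails (W : Expr → IProp S) (n : ℕ) (e : Expr) (m : S) : Prop :=
  ∀ a : Res S, valid a → (Auth.part (.ex m), 1, 1) ∣ a → (W e).holds n a

theorem SpecEntails.mono {W : Expr → IProp S} {n k : ℕ} {e : Expr} {m : S}
    (h : SpecEntails W n e m) (hk : k ≤ n) : SpecEntails W k e m :=
  fun a ha hm => (W e).mono (h a ha hm) dvd_rfl hk

theorem SpecEntails.bupd_sep {W : Expr → IProp S} {n : ℕ} {e : Expr} {m m' : S} {σ : State}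
    (h : SpecEntails W n e m') {x : Res S} (hx : ownedRes m σ ∣ x) :
    (bupd (sep (specInterp m') (sep (stateInterp σ) (W e)))).holds n x := by
  intro j hj c hc
  have hv := valid_ownedRes_mul (m' := m') hx hc
  -- Whatever `x` owns beyond `ownedRes m σ` is dropped; the new fragment goes to the `W e` part.
  refine ⟨ownedRes m' σ, hv, (Auth.full (.ex m'), 1, 1),
    (1, Auth.full (toExcl σ.heap), Auth.full (toExcl σ.tapes)) * (Auth.part (.ex m'), 1, 1),
    ?_, dvd_rfl, _, _, rfl, dvd_rfl, h.mono hj _ ?_ dvd_rfl⟩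
  · refine Prod.ext (mul_comm _ _) (Prod.ext ?_ ?_)
    · exact (one_mul _).symm
    · exact (one_mul _).symm
  · exact ⟨valid_of_mul _ _ (Auth.valid_part_mul_full m'), valid_one⟩

theorem ownedRes_mul_eq (m m' : S) (σ : State) (x y z : Res S) :
    (Auth.part (.ex m), 1, 1) * x * ((Auth.full (.ex m'), 1, 1) * y *
        ((1, Auth.full (toExcl σ.heap), Auth.full (toExcl σ.tapes)) * z)) =
      (Auth.part (.ex m) * Auth.full (.ex m'), Auth.full (toExcl σ.heap),
        Auth.full (toExcl σ.tapes)) * (x * y * z) := by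
  have e : (Auth.part (.ex m) * Auth.full (.ex m'), Auth.full (toExcl σ.heap),
      Auth.full (toExcl σ.tapes)) = ((Auth.part (.ex m), 1, 1) * (Auth.full (.ex m'), 1, 1) *
        (1, Auth.full (toExcl σ.heap), Auth.full (toExcl σ.tapes)) : Res S) :=
    Prod.ext (mul_one _).symm (Prod.ext (by simp) (by simp))
  rw [e]
  ac_rfl

/-- The weakest precondition quantifies over all model states, but validity forces the full view to
agree with the owned fragment, so only `m` remains. The outer update is used trivially. -/
theorem SpecEntails.of_execCoupl {W : Expr → IProp S} {Φ : Val → IProp S}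
    (hW : ∀ e, Entails (rwpPre M Φ W e) (W e)) {n : ℕ} {e : Expr} {m : S} (he : ¬ e.IsVal)
    (h : ∀ σ, ∀ k ≤ n, ∀ x : Res S, valid x → ownedRes m σ ∣ x →
      (execCoupl M m (e, σ) fun t =>
        bupd (sep (specInterp t.1) (sep (stateInterp t.2.2) (W t.2.1)))).holds k x) :
    SpecEntails W n e m := by
  rintro _ hv ⟨r, rfl⟩
  refine hW e n _ hv (Or.inr ⟨1, _, (one_mul _).symm, he, fun m₂ σ k hk b hb hI => ?_⟩)
  obtain ⟨_, _, rfl, ⟨r₁, rfl⟩, ⟨r₂, rfl⟩⟩ := hI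
  rw [ownedRes_mul_eq] at hb ⊢
  have h1 := hb.1
  change valid (Auth.part (.ex m) * Auth.full (.ex m₂) * (r.1 * r₁.1 * r₂.1)) at h1
  obtain rfl := (Auth.agree h1).1
  exact fun j hj c hc => ⟨_, hc, h σ j (hj.trans hk) _ hb (Dvd.intro _ rfl)⟩

/-- The silent rule is the first disjunct of the coupling precondition, the coupled rule the second,
whose later modality pays for the drop in the index. Both couplings run along the common uniform
sample. -/
theorem refinementRules_specEntails {W : Expr → IProp S} {Φ : Val → IProp S}
    (hW : ∀ e, Entails (rwpPre M Φ W e) (W e)) : RefinementRules M (SpecEntails W) where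
  silent {N n e e' m} he h := by
    refine SpecEntails.of_execCoupl hW he.not_isVal fun σ k hk x hv hx C hC => hC _ k x hv ?_
    refine Or.inl ⟨fun m' ρ => m' = m ∧ ∃ i, ρ = (e' i, σ), 1, x, (one_mul x).symm,
      ⟨he.red σ, ?_⟩, ?_⟩
    · change SubDistr.RCoupl (SubDistr.ret m) (primStep (e, σ)) _
      rw [he σ, ← SubDistr.map_const_uniform N]
      exact SubDistr.rcoupl_map _ _ _ _ fun i => ⟨rfl, i, rfl⟩
    · rintro ⟨⟨m', ρ⟩, hR⟩
      obtain ⟨rfl, i, rfl⟩ : m' = m ∧ ∃ i, ρ = (e' i, σ) := hR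
      exact ((h i).mono hk).bupd_sep hx
  coupled {N n e e' m} f he hf h := by
    refine SpecEntails.of_execCoupl hW he.not_isVal fun σ k hk x hv hx C hC => hC _ k x hv ?_
    refine Or.inr (Or.inl ⟨fun m' ρ => ∃ i, m' = f i ∧ ρ = (e' i, σ), 1, x, (one_mul x).symm,
      ⟨he.red σ, M.red_of_step_eq_map hf, ?_⟩, ?_⟩)
    · change SubDistr.RCoupl (M.step m) (primStep (e, σ)) _
      rw [he σ, hf]
      exact SubDistr.rcoupl_map _ _ _ _ fun i => ⟨i, rfl, rfl⟩
    · rintro ⟨⟨m', ρ⟩, hR⟩ j hj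
      obtain ⟨i, rfl, rfl⟩ : ∃ i, m' = f i ∧ ρ = (e' i, σ) := hR
      -- The later modality supplies `j < k`, hence `j < n`.
      exact (h i j (hj.trans_le hk)).bupd_sep hx

theorem specEntails_val {W : Expr → IProp S} {m : S}
    (hW : ∀ e, Entails (rwpPre M (fun _ => spec m) W e) (W e)) (n : ℕ) (v : Val) :
    SpecEntails W n (.val v) m := fun a hv ha =>
  hW _ n a hv (Or.inl ⟨v, 1, a, (one_mul a).symm, rfl, fun _ _ _ hc => ⟨a, hc, ha⟩⟩)

/-- `rwp` is the intersection of all pre-fixed points, so it suffices to treat each one as a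
judgement and run `e` in the empty context. -/
theorem entails_rwp_of_moves {e : Expr} {m m' : S}
    (h : ∀ G : ℕ → Expr → S → Prop, RefinementRules M G → e.Moves G m m') :
    Entails (spec m) (rwp M e fun _ => spec m') := fun n a hv ha _ hW =>
  h _ (refinementRules_specEntails hW) n [] (fun v i _ => specEntails_val hW i v) a hv ha

theorem provable_hoare_of_entails {P : IProp S} {e : Expr} {Φ : Val → IProp S}
    (h : Entails P (rwp M e Φ)) : Provable (hoare M P e Φ) := fun _ _ _ _ k _ _ hb hP =>
  h k _ hb (P.mono hP (Dvd.intro_left _ rfl) le_rfl)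

end Logic

-- The instance for termination probabilities.

/-- `e` terminates at least as often as the model does from `m` within `n` steps. -/
def TermRefines {S : Type*} (M : MarkovChain S) (n : ℕ) (e : Expr) (m : S) : Prop :=
  ∀ σ, M.termN n m ≤ langChain.execTerm (e, σ)

theorem Expr.StepsUniform.execTerm_eq {N : ℕ} {e : Expr} {e' : Fin (N + 1) → Expr}
    (h : e.StepsUniform e') (σ : State) : langChain.execTerm (e, σ) =
      (SubDistr.uniform N).expect fun k => langChain.execTerm (e' k, σ) := by
  rw [langChain.execTerm_eq_expect (langChain.not_isFinal_of_red (h.red σ))]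
  change (primStep (e, σ)).expect _ = _
  rw [h σ, SubDistr.expect_map]
  rfl

theorem refinementRules_termRefines {S : Type*} (M : MarkovChain S) :
    RefinementRules M (TermRefines M) where
  silent {N n e e' m} he h σ := by
    -- The model's side becomes the average of a constant over the program's sample, so the bounds
    -- can be compared pointwise.
    rw [he.execTerm_eq, ← SubDistr.expect_ret m (M.termN n), ← SubDistr.map_const_uniform N,
      SubDistr.expect_map]
    exact SubDistr.expect_mono _ fun k => h k σ
  coupled {N n e e' m} f he hf h σ := by
    have hm := M.not_isFinal_of_red (M.red_of_step_eq_map hf)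
    cases n with
    -- At index 0 nothing is known of the successors, but a reducible model state is not final and
    -- has terminated with probability 0.
    | zero => simp [M.termN_zero hm]
    | succ n =>
      rw [he.execTerm_eq, M.termN_succ hm, hf, SubDistr.expect_map]
      exact SubDistr.expect_mono _ fun k => h k n n.lt_succ_self σ

/-- The bound holds for every number of model steps, hence for the supremum. A returned value has
terminated with probability 1, so it refines any `m'`, final or not. -/
theorem execTerm_le_of_moves {S : Type*} {M : MarkovChain S} {e : Expr} {m m' : S}
    (h : ∀ G : ℕ → Expr → S → Prop, RefinementRules M G → e.Moves G m m') (σ : State) :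
    M.execTerm m ≤ langChain.execTerm (e, σ) := by
  rw [M.execTerm_eq_iSup]
  refine iSup_le fun n => h _ (refinementRules_termRefines M) n [] (fun v i _ σ => ?_) σ
  rw [langChain.execTerm_of_final ⟨v, rfl⟩]
  exact M.termN_le_one i m'

-- The three-state model and the two generators.

theorem genChain_step_q1 :
    genChain.step .q1 = SubDistr.map ![.q1, .q0] (SubDistr.uniform 1) := by
  ext s
  rw [SubDistr.mass_eq_expect, SubDistr.mass_eq_expect, SubDistr.expect_map]
  simp only [SubDistr.expect, sum_genState, tsum_fintype, Fin.sum_univ_two, SubDistr.uniform,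
    genChain, genProb, Function.comp_apply, Matrix.cons_val_zero, Matrix.cons_val_one]
  cases s <;> simp [one_add_one_eq_two]

theorem genChain_step_q0 :
    genChain.step .q0 = SubDistr.map ![.q1, .qf] (SubDistr.uniform 1) := by
  ext s
  rw [SubDistr.mass_eq_expect, SubDistr.mass_eq_expect, SubDistr.expect_map]
  simp only [SubDistr.expect, sum_genState, tsum_fintype, Fin.sum_univ_two, SubDistr.uniform,
    genChain, genProb, Function.comp_apply, Matrix.cons_val_zero, Matrix.cons_val_one]
  cases s <;> simp [one_add_one_eq_two]

/-- The element's flip is silent, so the element function leaves the model at `q1`. -/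
theorem innerGen_moves {G : ℕ → Expr → GenState → Prop} (hG : RefinementRules genChain G) :
    innerGen.Moves G .q1 .q0 :=
  hG.listgen_moves (fun z u => by simp [Val.lam, Val.subst, Expr.subst, Expr.flip])
    genChain_step_q1 fun n K hK => hG.beta K (hG.flip K fun b => hK _ n le_rfl)

theorem nestedGen_moves {G : ℕ → Expr → GenState → Prop} (hG : RefinementRules genChain G) :
    nestedGen.Moves G .q0 .qf :=
  hG.listgen_moves
    (fun z u => by simp [Val.lam, Val.subst, Expr.subst, Expr.flip, innerGen, subst_listgen])
    genChain_step_q0 fun n K hK => hG.beta K (innerGen_moves hG n K hK)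

theorem genChain_isRankingSupermartingale :
    genChain.IsRankingSupermartingale genRank (1 / 2) where
  pos := by norm_num
  total s hs := by
    rw [sum_genState]
    cases s
    · exact (hs rfl).elim
    all_goals simp [genChain, genProb, ENNReal.inv_two_add_inv_two]
  decrease s hs := by
    rw [sum_genState]
    cases s
    · exact (hs rfl).elim
    -- The sum lists `qf`, `q0`, `q1` in this order; the inequality is an equality here and at `q1`.
    · suffices h : ((1 / 2 * 0 + (0 * 2 + 1 / 2 * 3) + 1 / 2 : ℝ≥0) : ℝ≥0∞) ≤ (2 : ℝ≥0) by
        simpa [genChain, genProb, genRank] using h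
      exact_mod_cast (by norm_num : (1 / 2 * 0 + (0 * 2 + 1 / 2 * 3) + 1 / 2 : ℝ≥0) ≤ 2)
    · suffices h : ((0 * 0 + (1 / 2 * 2 + 1 / 2 * 3) + 1 / 2 : ℝ≥0) : ℝ≥0∞) ≤ (3 : ℝ≥0) by
        simpa [genChain, genProb, genRank, ENNReal.inv_mul_cancel] using h
      exact_mod_cast (by norm_num : (0 * 0 + (1 / 2 * 2 + 1 / 2 * 3) + 1 / 2 : ℝ≥0) ≤ 3)

theorem genChain_step_mass (s s' : GenState) : (genChain.step s).mass s' = genProb s s' := rfl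

/-- With `x₀`, `x₁` the probabilities from `q0`, `q1`, the one-step equations are `x₀ = 1/2 + x₁/2`
and `x₁ = x₁/2 + x₀/2`. The second gives `x₁ = x₀`, the first then `x₀ = 1`; finiteness permits the
subtraction. The ranking function plays no part. -/
theorem genChain_execTerm (q : GenState) : genChain.execTerm q = 1 := by
  have hf : genChain.execTerm .qf = 1 := genChain.execTerm_of_final rfl
  have e0 := genChain.execTerm_eq_expect (s := .q0) (by rintro ⟨⟩)
  have e1 := genChain.execTerm_eq_expect (s := .q1) (by rintro ⟨⟩)
  simp only [SubDistr.expect, sum_genState, genChain_step_mass, genProb, hf, zero_mul, zero_add,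
    mul_one] at e0 e1
  have t : ∀ q, genChain.execTerm q ≠ ⊤ := fun q =>
    ((genChain.execTerm_le_one q).trans_lt ENNReal.one_lt_top).ne
  have r0 := congrArg ENNReal.toReal e0
  have r1 := congrArg ENNReal.toReal e1
  rw [ENNReal.toReal_add (by finiteness) (ENNReal.mul_ne_top (by finiteness) (t _))] at r0
  rw [ENNReal.toReal_add (ENNReal.mul_ne_top (by finiteness) (t _))
    (ENNReal.mul_ne_top (by finiteness) (t _))] at r1
  simp only [ENNReal.toReal_mul, ENNReal.toReal_div, ENNReal.toReal_one, ENNReal.toReal_ofNat]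
    at r0 r1
  cases q
  · exact hf
  all_goals
    rw [← ENNReal.toReal_eq_one_iff]
    linarith

end Caliper

theorem mainTheorem5 :
    -- the specifications of the inner and of the outer generator
    UPred.Provable (hoare genChain (spec .q1) innerGen fun _ => spec .q0) ∧
    UPred.Provable (hoare genChain (spec .q0) nestedGen fun _ => spec .qf) ∧
    -- refinement, and preservation of termination from every initial program state
    UPred.Entails (spec .q0) (rwp genChain nestedGen fun _ => spec .qf) ∧
    (∀ σ : State, genChain.execTerm .q0 ≤ langChain.execTerm (nestedGen, σ)) ∧
    -- the model has the ranking supermartingale and terminates almost surely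
    genChain.IsRankingSupermartingale genRank (1 / 2) ∧
    (∀ q : GenState, genChain.execTerm q = 1) ∧
    -- hence so does the program
    (∀ σ : State, langChain.execTerm (nestedGen, σ) = 1) :=
  have inner := entails_rwp_of_moves fun _ hG => innerGen_moves hG
  have nested := entails_rwp_of_moves fun _ hG => nestedGen_moves hG
  have refines := execTerm_le_of_moves fun _ hG => nestedGen_moves hG
  ⟨provable_hoare_of_entails inner, provable_hoare_of_entails nested, nested, refines,
    genChain_isRankingSupermartingale, genChain_execTerm, fun σ =>
    (langChain.execTerm_le_one _).antisymm ((genChain_execTerm .q0).ge.trans (refines σ))⟩
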